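/- Let $\mathcal H$ be a separable (possibly finite-dimensional) complex Hilbert space, let $X$ be a locally compact Hausdorff space with its Borel $\sigma$-algebra $\mathcal O(X)$, and let $\mathcal S(\mathcal H)$ be the set of density operators (positive operators of trace one) on $\mathcal H$. Let $\nu:\mathcal O(X)\to\mathcal B(\mathcal H)$ be a positive operator-valued measure, i.e. $\nu(E)\ge 0$ for all $E$ and $\nu$ is ultraweakly countably additive: $\operatorname{tr}\big(s\,\nu(\bigcup_k E_k)\big)=\sum_k \operatorname{tr}(s\,\nu(E_k))$ for all disjoint Borel sets $E_1,E_2,\dots$ and all $s\in\mathcal S(\mathcal H)$. Let $\rho\in\mathcal S(\mathcal H)$ be of full rank (injective) and let $\nu_\rho(E)=\operatorname{tr}(\rho\,\nu(E))$, a finite positive Borel measure. A quantum random variable is a function $f:X\to\mathcal B(\mathcal H)$ such that $x\mapsto\operatorname{tr}(sf(x))$ is Borel measurable for every $s\in\mathcal S(\mathcal H)$; $\mathcal L_{\mathcal H}(X,\nu)$ denotes the complex linear span of the positive quantum random variables. Assume that $\nu$ has a Radon-Nikodým derivative $D=\frac{d\nu}{d\nu_\rho}$ which is a quantum random variable (with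 values in the bounded operators); that is, for an orthonormal basis $(e_i)$ of $\mathcal H$ the entries $\langle D(\cdot)e_j,e_i\rangle$ are $\nu_\rho$-integrable and $\int_E\langle D(x)e_j,e_i\rangle\,d\nu_\rho(x)=\langle\nu(E)e_j,e_i\rangle$ for all $i,j$ and all Borel sets $E$. For $A\in\mathcal B(\mathcal H)$ let $\|A\|_{S^p}=\operatorname{tr}(|A|^p)^{1/p}\in[0,\infty]$ for $1\le p<\infty$ and let $\|A\|_{S^\infty}$ be the operator norm. For $f\in\mathcal L_{\mathcal H}(X,\nu)$ and $p,q\in[1,\infty]$ put \[ \|f\|_{S^p,L^q}=\sup_{s\in\mathcal S(\mathcal H)}\Big\|\,\big\|s^{1/2}D^{1/2}fD^{1/2}s^{1/2}\big\|_{S^p}\Big\|_{L^q(X,\nu_\rho)}\in[0,\infty]. \] If $f,g\in\mathcal L_{\mathcal H}(X,\nu)$ and $p,q\in[1,\infty]$ satisfy $\frac1p+\frac1q=1$, then (with $0\cdot\infty=0$) \[ \sup_{s\in\mathcal S(\mathcal H)}\Big\|\,\big\|s^{1/2}D^{1/2}fD^{1/2}\,s\,D^{1/2}gD^{1/2}s^{1/2}\big\|_{S^1}\Big\|_{L^1(X,\nu_\rho)}\le\|f\|_{S^p,L^p}\,\|g\|_{S^q,L^q}.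 \] -/

import Mathlib

open MeasureTheory
open scoped ENNReal InnerProductSpace

namespace OpLp

noncomputable section

section Trace

variable (H : Type*) [NormedAddCommGroup H] [InnerProductSpace ℂ H] [CompleteSpace H]

/-- A fixed orthonormal basis of the Hilbert space, in which traces are computed. (The trace of a
trace class operator, and the extended trace of a positive operator, do not depend on it.) -/
def onb : HilbertBasis (exists_hilbertBasis ℂ H).choose ℂ H :=
  (exists_hilbertBasis ℂ H).choose_spec.choose

variable {H}

/-- The trace `∑ i, ⟨A e_i, e_i⟩`; it is only ever applied to trace class operators. -/
def tr (A : H →L[ℂ] H) : ℂ := ∑' i, ⟪onb H i, A (onb H i)⟫_ℂ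

/-- The `[0, ∞]`-valued trace of a positive operator. -/
def posTr (A : H →L[ℂ] H) : ℝ≥0∞ := ∑' i, ENNReal.ofReal (⟪onb H i, A (onb H i)⟫_ℂ).re

/-- The Schatten norm `(tr |A|^p)^(1/p)`, with values in `[0, ∞]`; for `p = ∞` the operator norm. -/
def schattenNorm (p : ℝ≥0∞) (A : H →L[ℂ] H) : ℝ≥0∞ :=
  if p = ∞ then ‖A‖ₑ else (posTr (CFC.abs A ^ p.toReal)) ^ (1 / p.toReal)

variable (H) in
/-- The density operators (states): positive operators of trace one. (If `tr s = 1`, then the series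
defining the trace converges, as the value of a divergent sum is `0`.) -/
def densityOperators : Set (H →L[ℂ] H) := {s | 0 ≤ s ∧ tr s = 1}

end Trace

section HelperFacts

variable {H : Type*} [NormedAddCommGroup H] [InnerProductSpace ℂ H] [CompleteSpace H]

lemma sqrt_adjoint_apply (s : H →L[ℂ] H) (u v : H) :
    ⟪CFC.sqrt s u, v⟫_ℂ = ⟪u, CFC.sqrt s v⟫_ℂ := by
  have h : IsSelfAdjoint (CFC.sqrt s) := (CFC.sqrt_nonneg s).isSelfAdjoint
  rw [← ContinuousLinearMap.adjoint_inner_right, ← ContinuousLinearMap.star_eq_adjoint, h.star_eq]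

/-- `tr (ρ A) ≥ 0` for a density operator `ρ` and a positive operator `A`. -/
lemma tr_mul_re_nonneg {ρ A : H →L[ℂ] H} (hρ : ρ ∈ densityOperators H) (hA : 0 ≤ A) :
    0 ≤ (tr (ρ * A)).re := by
  obtain ⟨hρ0, hρ1⟩ := hρ
  set b := onb H with hb
  set r := CFC.sqrt ρ with hr
  have hrr : r * r = ρ := CFC.sqrt_mul_sqrt_self ρ hρ0
  have hAsa : ∀ u v : H, ⟪A u, v⟫_ℂ = ⟪u, A v⟫_ℂ := by
    intro u v
    rw [← ContinuousLinearMap.adjoint_inner_right, ← ContinuousLinearMap.star_eq_adjoint,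
      hA.isSelfAdjoint.star_eq]
  have hsum1 : Summable fun i => ⟪b i, ρ (b i)⟫_ℂ := by
    by_contra h
    have : tr ρ = 0 := tsum_eq_zero_of_not_summable h
    rw [this] at hρ1
    exact zero_ne_one hρ1
  have hsq : ∀ i, (‖r (b i)‖ ^ 2 : ℝ) = (⟪b i, ρ (b i)⟫_ℂ).re := by
    intro i
    rw [← hrr, mul_apply_eq_comp, ← sqrt_adjoint_apply, ← hr,
      inner_self_eq_norm_sq_to_K]
    norm_cast
  have hS : Summable fun i => ‖r (b i)‖ ^ 2 := by
    simp_rw [hsq]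
    exact (Complex.hasSum_re hsum1.hasSum).summable
  have hpars : ∀ v : H, HasSum (fun k => ‖⟪b k, v⟫_ℂ‖ ^ 2) (‖v‖ ^ 2) := by
    intro v
    have h := Complex.hasSum_re (b.hasSum_inner_mul_inner v v)
    rw [inner_self_eq_norm_sq_to_K] at h
    convert h using 1
    · funext k
      rw [← inner_conj_symm v (b k), RCLike.conj_mul]
      norm_cast
    · norm_cast
  have hD : ∀ v : (exists_hilbertBasis ℂ H).choose → H, (Summable fun k => ‖v k‖ ^ 2) →
      Summable fun z : (exists_hilbertBasis ℂ H).choose × (exists_hilbertBasis ℂ H).choose =>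
        ‖⟪b z.2, v z.1⟫_ℂ‖ ^ 2 := by
    intro v hv
    refine (summable_prod_of_nonneg fun z => by positivity).2
      ⟨fun k => (hpars (v k)).summable, ?_⟩
    simpa only [(hpars _).tsum_eq] using hv
  have hS2 : Summable fun k => ‖A (r (b k))‖ ^ 2 := by
    refine Summable.of_nonneg_of_le (fun k => by positivity) (fun k => ?_) (hS.mul_left (‖A‖ ^ 2))
    rw [← mul_pow]
    gcongr
    exact A.le_opNorm _
  set F : (exists_hilbertBasis ℂ H).choose → (exists_hilbertBasis ℂ H).choose → ℂ :=
    fun k i => ⟪A (r (b k)), b i⟫_ℂ * ⟪b i, r (b k)⟫_ℂ with hF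
  have hFs : Summable (Function.uncurry F) := by
    refine Summable.of_norm_bounded ((hD _ hS2).add (hD _ hS)) ?_
    rintro ⟨k, i⟩
    simp only [Function.uncurry, hF, norm_mul]
    rw [← inner_conj_symm, RCLike.norm_conj]
    nlinarith [sq_nonneg (‖⟪b i, A (r (b k))⟫_ℂ‖ - ‖⟪b i, r (b k)⟫_ℂ‖),
      sq_nonneg (‖⟪b i, A (r (b k))⟫_ℂ‖), sq_nonneg (‖⟪b i, r (b k)⟫_ℂ‖)]
  have h1 : ∀ k, ∑' i, F k i = ⟪A (r (b k)), r (b k)⟫_ℂ := fun k =>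
    b.tsum_inner_mul_inner _ _
  have h2 : ∀ i, ∑' k, F k i = ⟪b i, (ρ * A) (b i)⟫_ℂ := by
    intro i
    have : ⟪b i, (ρ * A) (b i)⟫_ℂ = ⟪r (b i), r (A (b i))⟫_ℂ := by
      rw [← hrr, sqrt_adjoint_apply]; rfl
    rw [this, ← b.tsum_inner_mul_inner]
    refine tsum_congr fun k => ?_
    simp only [hF]
    rw [hAsa, sqrt_adjoint_apply, ← sqrt_adjoint_apply ρ (b i), mul_comm]
  have h3 : tr (ρ * A) = ∑' k, ⟪A (r (b k)), r (b k)⟫_ℂ := by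
    calc tr (ρ * A) = ∑' i, ∑' k, F k i := (tsum_congr h2).symm
      _ = ∑' k, ∑' i, F k i := hFs.tsum_comm
      _ = _ := tsum_congr h1
  rw [h3, Complex.re_tsum]
  · refine tsum_nonneg fun k => ?_
    have h := ((ContinuousLinearMap.nonneg_iff_isPositive A).1 hA).re_inner_nonneg_left (r (b k))
    exact h
  · have h := hFs.prod
    simp only [Function.uncurry_apply_pair, h1] at h
    exact h

end HelperFacts

section Measure

variable (X : Type*) [MeasurableSpace X]
  (H : Type*) [NormedAddCommGroup H] [InnerProductSpace ℂ H] [CompleteSpace H]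

/-- A positive operator-valued measure: an ultraweakly countably additive map from the measurable
sets to the positive operators. (Values on non-measurable sets are irrelevant.) -/
structure POVM where
  /-- The operator assigned to a set. -/
  toFun : Set X → (H →L[ℂ] H)
  nonneg : ∀ E, MeasurableSet E → 0 ≤ toFun E
  hasSum_tr : ∀ E : ℕ → Set X, (∀ k, MeasurableSet (E k)) → Pairwise (Function.onFun Disjoint E) →
    ∀ s ∈ densityOperators H, HasSum (fun k => tr (s * toFun (E k))) (tr (s * toFun (⋃ k, E k)))

variable {X H}

/-- The scalar measure `ν_ρ(E) = tr (ρ ν(E))`. -/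
def POVM.scalar (ν : POVM X H) (ρ : H →L[ℂ] H) (hρ : ρ ∈ densityOperators H) : Measure X :=
  Measure.ofMeasurable (fun E _ => ENNReal.ofReal (tr (ρ * ν.toFun E)).re)
    (by
      have h := (ν.hasSum_tr (fun _ => ∅) (fun _ => MeasurableSet.empty)
        (fun _ _ _ => disjoint_bot_left) ρ hρ).summable
      have h0 : tr (ρ * ν.toFun ∅) = 0 := (summable_const_iff _).1 h
      simp [h0])
    (by
      intro E hE hd
      have h := Complex.hasSum_re (ν.hasSum_tr E hE hd ρ hρ)
      rw [← h.tsum_eq]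
      exact ENNReal.ofReal_tsum_of_nonneg
        (fun k => tr_mul_re_nonneg hρ (ν.nonneg _ (hE k))) h.summable)

/-- A quantum random variable: `x ↦ tr (s f(x))` is measurable for every density operator `s`. -/
def IsQuantumRandomVariable (f : X → H →L[ℂ] H) : Prop :=
  ∀ s ∈ densityOperators H, Measurable fun x => tr (s * f x)

variable (X H) in
/-- The linear span of the positive quantum random variables. -/
def spanPositive : Submodule ℂ (X → H →L[ℂ] H) :=
  Submodule.span ℂ {f | IsQuantumRandomVariable f ∧ ∀ x, 0 ≤ f x}

/-- `D` is (a version of) the Radon-Nikodým derivative `dν/dμ`: a quantum random variable, with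
values in the bounded operators, whose matrix entries `⟨D e_j, e_i⟩` in the orthonormal basis `e`
are integrable densities with respect to `μ` of the complex measures `E ↦ ⟨ν(E) e_j, e_i⟩`. -/
structure POVM.IsRNDeriv {ι : Type*} (ν : POVM X H) (μ : Measure X) (e : HilbertBasis ι ℂ H)
    (D : X → H →L[ℂ] H) : Prop where
  isQuantumRandomVariable : IsQuantumRandomVariable D
  integrable : ∀ i j, Integrable (fun x => ⟪e i, D x (e j)⟫_ℂ) μ
  setIntegral_eq : ∀ i j, ∀ E, MeasurableSet E →
    ∫ x in E, ⟪e i, D x (e j)⟫_ℂ ∂μ = ⟪e i, ν.toFun E (e j)⟫_ℂ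

/-- The norm `‖f‖_{S^p, L^q}`: the supremum over the density operators `s` of the `L^q(μ)` norm of
the Schatten `p`-norm of `s^{1/2} D^{1/2} f D^{1/2} s^{1/2}`. -/
def schattenLpNorm (p q : ℝ≥0∞) (μ : Measure X) (D f : X → H →L[ℂ] H) : ℝ≥0∞ :=
  ⨆ s ∈ densityOperators H, eLpNorm (fun x => schattenNorm p
    (CFC.sqrt s * CFC.sqrt (D x) * f x * CFC.sqrt (D x) * CFC.sqrt s)) q μ

end Measure

end

end OpLp

/-! Fix a state `s`, let `r = s^{1/2}` and `T_f = r D^{1/2} f D^{1/2} r`. Since `s = r r`, the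
operator on the left is the product `T_f T_g`. The theorem therefore reduces to Hölder twice:
pointwise for Schatten norms (`schattenNorm_one_mul_le`), then for the scalar functions
`‖T_f‖_{S^p}` and `‖T_g‖_{S^q}` over `ν_ρ`. The same `s` occurs in both factors, so each is at most
its own supremum.

Schatten Hölder is needed only for compact operators, because `tr s = 1` makes `r` Hilbert-Schmidt.
Take orthonormal bases `y`, `w`, `t` diagonalising `A*A`, `B*B` and `(AB)*(AB)`. Expanding a partial
sum of the singular values of `AB` along `w` and `y` bounds it by `∑ a_k b_l ω_{lk}`, with `a_k`,
`b_l` the singular values of `A`, `B`. Bessel and Cauchy-Schwarz make `ω` doubly substochastic, so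
Hölder for the measure with weights `ω` finishes, with infinite values allowed.

Scalar Hölder needs measurable Schatten norms. In a separable space, measurability of matrix
coefficients survives products, adjoints and continuous functional calculus, hence passes to
`|T_f|^p` and its trace. -/

namespace OpLp

noncomputable section

/-! ### Hölder inequalities for integrals and weighted double sums -/

section Holder

/-- Hölder's inequality for `ℝ≥0∞`-valued functions, including the exponents `1` and `∞`. -/
lemma lintegral_mul_le_eLpNorm_mul_eLpNorm {α : Type*} [MeasurableSpace α] {μ : Measure α}
    {a b : α → ℝ≥0∞} (ha : AEMeasurable a μ) (hb : AEMeasurable b μ) {p q : ℝ≥0∞}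
    (hpq : 1 / p + 1 / q = 1) :
    ∫⁻ x, a x * b x ∂μ ≤ eLpNorm a p μ * eLpNorm b q μ := by
  have hle : ∀ u : α → ℝ≥0∞, ∀ᵐ x ∂μ, u x ≤ eLpNorm u ∞ μ := fun u => by
    simpa [eLpNorm_exponent_top] using enorm_ae_le_eLpNormEssSup u μ
  -- At an infinite exponent the norm is an almost everywhere bound, which leaves the integral as a
  -- constant, possibly `∞`.
  by_cases hp : p = ∞
  · subst hp
    have hq : q = 1 := by simpa using hpq
    subst hq
    calc ∫⁻ x, a x * b x ∂μ ≤ ∫⁻ x, eLpNorm a ∞ μ * b x ∂μ :=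
          lintegral_mono_ae ((hle a).mono fun x hx => by gcongr)
      _ = _ := by rw [lintegral_const_mul'' _ hb, eLpNorm_one_eq_lintegral_enorm]; simp
  by_cases hq : q = ∞
  · subst hq
    have hp : p = 1 := by simpa using hpq
    subst hp
    calc ∫⁻ x, a x * b x ∂μ ≤ ∫⁻ x, a x * eLpNorm b ∞ μ ∂μ :=
          lintegral_mono_ae ((hle b).mono fun x hx => by gcongr)
      _ = _ := by rw [lintegral_mul_const'' _ ha, eLpNorm_one_eq_lintegral_enorm]; simp
  have hp0 : p ≠ 0 := by rintro rfl; simp at hpq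
  have hq0 : q ≠ 0 := by rintro rfl; simp at hpq
  have hc : p.toReal.HolderConjugate q.toReal := by
    have hp' := ENNReal.toReal_pos hp0 hp
    have hq' := ENNReal.toReal_pos hq0 hq
    have h := congrArg ENNReal.toReal hpq
    rw [ENNReal.toReal_add (by simpa using hp0) (by simpa using hq0)] at h
    simp only [one_div, ENNReal.toReal_inv, ENNReal.toReal_one] at h
    exact ⟨by simpa using h, hp', hq'⟩
  have h := ENNReal.lintegral_mul_le_Lp_mul_Lq μ hc ha hb
  rw [eLpNorm_eq_lintegral_rpow_enorm_toReal hp0 hp, eLpNorm_eq_lintegral_rpow_enorm_toReal hq0 hq]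
  simpa using h

/-- The `ℓ^p` norm of a family of extended nonnegative reals. -/
def ellNorm {K : Type*} (p : ℝ≥0∞) (a : K → ℝ≥0∞) : ℝ≥0∞ :=
  if p = ∞ then ⨆ k, a k else (∑' k, a k ^ p.toReal) ^ (1 / p.toReal)

/-- Hölder's inequality for sums with doubly substochastic weights. -/
lemma tsum_tsum_mul_le_ellNorm_mul_ellNorm {K L : Type*} (a : K → ℝ≥0∞) (b : L → ℝ≥0∞)
    (w : K → L → ℝ≥0∞) (hrow : ∀ k, ∑' l, w k l ≤ 1) (hcol : ∀ l, ∑' k, w k l ≤ 1)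
    {p q : ℝ≥0∞} (hpq : 1 / p + 1 / q = 1) :
    ∑' k, ∑' l, a k * b l * w k l ≤ ellNorm p a * ellNorm q b := by
  -- The discrete σ-algebra makes every function measurable, so the index sets may be uncountable.
  let _ : MeasurableSpace (K × L) := ⊤
  set m : Measure (K × L) := Measure.count.withDensity fun z => w z.1 z.2 with hm
  have hmeas : ∀ u : K × L → ℝ≥0∞, Measurable u := fun u => measurable_from_top
  have hint : ∀ u : K × L → ℝ≥0∞, ∫⁻ z, u z ∂m = ∑' k, ∑' l, u (k, l) * w k l := fun u => by
    rw [hm, lintegral_withDensity_eq_lintegral_mul _ (hmeas _) (hmeas _), lintegral_count,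
      ENNReal.tsum_prod']
    simp [mul_comm]
  have hbound : ∀ (r : ℝ≥0∞) (u : K × L → ℝ≥0∞) (n : ℝ≥0∞), r ≠ 0 → (r = ∞ → ∀ z, u z ≤ n) →
      (r ≠ ∞ → (∑' k, ∑' l, u (k, l) ^ r.toReal * w k l) ^ (1 / r.toReal) ≤ n) →
      eLpNorm u r m ≤ n := by
    intro r u n hr h1 h2
    by_cases hr' : r = ∞
    · subst hr'
      rw [eLpNorm_exponent_top]
      exact essSup_le_of_ae_le _ (Filter.Eventually.of_forall fun z => by simpa using h1 rfl z)
    · rw [eLpNorm_eq_lintegral_rpow_enorm_toReal hr hr', hint]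
      simpa using h2 hr'
  have hp0 : p ≠ 0 := by rintro rfl; simp at hpq
  have hq0 : q ≠ 0 := by rintro rfl; simp at hpq
  calc ∑' k, ∑' l, a k * b l * w k l = ∫⁻ z, a z.1 * b z.2 ∂m :=
      (hint fun z => a z.1 * b z.2).symm
    _ ≤ eLpNorm (fun z : K × L => a z.1) p m * eLpNorm (fun z : K × L => b z.2) q m :=
      lintegral_mul_le_eLpNorm_mul_eLpNorm (hmeas _).aemeasurable (hmeas _).aemeasurable hpq
    _ ≤ ellNorm p a * ellNorm q b := by
      gcongr
      · refine hbound p _ _ hp0 (fun h z => ?_) fun h => ?_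
        · simpa [ellNorm, h] using le_iSup a z.1
        · rw [ellNorm, if_neg h]
          gcongr with k
          simp only [ENNReal.tsum_mul_left]
          exact mul_le_of_le_one_right' (hrow k)
      · refine hbound q _ _ hq0 (fun h z => ?_) fun h => ?_
        · simpa [ellNorm, h] using le_iSup b z.2
        · rw [ellNorm, if_neg h, ENNReal.tsum_comm]
          gcongr with l
          simp only [ENNReal.tsum_mul_left]
          exact mul_le_of_le_one_right' (hcol l)

/-- The Cauchy-Schwarz inequality for families in the unit ball of `ℓ²`. -/
lemma tsum_mul_le_one_of_sq {K : Type*} {a b : K → ℝ≥0∞} (ha : ∑' k, a k ^ 2 ≤ 1)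
    (hb : ∑' k, b k ^ 2 ≤ 1) : ∑' k, a k * b k ≤ 1 := by
  let _ : MeasurableSpace K := ⊤
  have h := ENNReal.lintegral_mul_le_Lp_mul_Lq (Measure.count : Measure K)
    Real.HolderConjugate.two_two (f := a) (g := b) measurable_from_top.aemeasurable
    measurable_from_top.aemeasurable
  simp only [lintegral_count, Pi.mul_apply, ENNReal.rpow_ofNat] at h
  refine h.trans (mul_le_one' ?_ ?_) <;> exact ENNReal.rpow_le_one ‹_› (by norm_num)

end Holder

/-! ### Polynomial approximation and eigenvectors -/

section FunctionalCalculus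

open Filter Topology Polynomial
open scoped NNReal

variable {H : Type*} [NormedAddCommGroup H] [InnerProductSpace ℂ H] [CompleteSpace H]

/-- A continuous function of positive operators is a pointwise limit of polynomials. -/
lemma exists_polynomial_tendsto_cfc {φ : ℝ≥0 → ℝ≥0} (hφ : Continuous φ) :
    ∃ P : ℕ → ℝ[X], (∀ t : ℝ≥0, Tendsto (fun n => (P n).eval (t : ℝ)) atTop (𝓝 (φ t : ℝ))) ∧
      ∀ a : H →L[ℂ] H, 0 ≤ a → Tendsto (fun n => aeval a (P n)) atTop (𝓝 (cfc φ a)) := by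
  set ψ : ℝ → ℝ := fun t => φ t.toNNReal with hψ
  have hψc : Continuous ψ := by fun_prop
  -- One sequence serves all operators: `P n` is `1/(n+1)`-close to `ψ` on `[0, n]`, which
  -- eventually contains any given positive spectrum.
  choose P hP using fun n : ℕ => exists_polynomial_near_of_continuousOn 0 n ψ hψc.continuousOn
    (1 / ((n : ℝ) + 1)) Nat.one_div_pos_of_nat
  refine ⟨P, fun t => ?_, fun a ha => ?_⟩
  · rw [tendsto_iff_dist_tendsto_zero]
    refine squeeze_zero' (Eventually.of_forall fun n => dist_nonneg) ?_
      tendsto_one_div_add_atTop_nhds_zero_nat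
    filter_upwards [eventually_ge_atTop ⌈(t : ℝ)⌉₊] with n hn
    have h := hP n t ⟨t.2, (Nat.le_ceil _).trans (by exact_mod_cast hn)⟩
    simpa [hψ, Real.dist_eq] using h.le
  · rw [tendsto_iff_norm_sub_tendsto_zero, cfc_nnreal_eq_real φ a ha]
    refine squeeze_zero' (Eventually.of_forall fun n => norm_nonneg _) ?_
      tendsto_one_div_add_atTop_nhds_zero_nat
    filter_upwards [eventually_ge_atTop ⌈‖a‖ * ‖(1 : H →L[ℂ] H)‖⌉₊] with n hn
    have hsa : IsSelfAdjoint a := .of_nonneg ha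
    rw [← cfc_polynomial (P n) a hsa, ← cfc_sub _ _ a (P n).continuous.continuousOn
      hψc.continuousOn]
    refine norm_cfc_le Nat.one_div_pos_of_nat.le fun t ht => ?_
    have h1 := spectrum.norm_le_norm_mul_of_mem ht
    exact (hP n t ⟨spectrum_nonneg_of_nonneg ha ht, (le_abs_self t).trans (h1.trans
      ((Nat.le_ceil _).trans (by exact_mod_cast hn)))⟩).le

lemma aeval_apply_of_eigenvector {H : Type*} [NormedAddCommGroup H] [InnerProductSpace ℂ H]
    {a : H →L[ℂ] H} {t : ℝ} {x : H} (hx : a x = (t : ℂ) • x)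
    (P : ℝ[X]) : aeval a P x = ((P.eval t : ℝ) : ℂ) • x := by
  induction P using Polynomial.induction_on' with
  | add P Q hP hQ => simp [hP, hQ, add_smul]
  | monomial n r =>
    have h : ∀ n : ℕ, (a ^ n) x = ((t : ℂ) ^ n) • x := by
      intro n
      induction n with
      | zero => simp
      | succ n ih => rw [pow_succ', mul_apply_eq_comp, ih, map_smul, hx, smul_smul, pow_succ]
    simp [aeval_monomial, h, Algebra.algebraMap_eq_smul_one, mul_smul]

/-- Eigenvectors of a positive operator are eigenvectors of its continuous functions. -/
lemma cfc_apply_of_eigenvector {φ : ℝ≥0 → ℝ≥0} (hφ : Continuous φ) {a : H →L[ℂ] H} (ha : 0 ≤ a)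
    {t : ℝ≥0} {x : H} (hx : a x = ((t : ℝ) : ℂ) • x) : cfc φ a x = ((φ t : ℝ) : ℂ) • x := by
  obtain ⟨P, hP, hPa⟩ := exists_polynomial_tendsto_cfc (H := H) hφ
  have h1 : Tendsto (fun n => aeval a (P n) x) atTop (𝓝 (cfc φ a x)) :=
    ((ContinuousLinearMap.apply ℂ H x).continuous.tendsto _).comp (hPa a ha)
  refine tendsto_nhds_unique h1 ?_
  simp only [aeval_apply_of_eigenvector hx]
  exact ((Complex.continuous_ofReal.tendsto _).comp (hP t)).smul_const x

end FunctionalCalculus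

/-! ### Compact operators, traces and singular values -/

section Compact

universe u

variable {H : Type u} [NormedAddCommGroup H] [InnerProductSpace ℂ H] [CompleteSpace H]

open Filter Topology

lemma tsum_enorm_inner_sq {H : Type*} [NormedAddCommGroup H] [InnerProductSpace ℂ H]
    {ι : Type*} (b : HilbertBasis ι ℂ H) (v : H) :
    ∑' k, ‖⟪b k, v⟫_ℂ‖ₑ ^ 2 = ‖v‖ₑ ^ 2 := by
  have h := Complex.hasSum_re (b.hasSum_inner_mul_inner v v)
  have h' : HasSum (fun k => ‖⟪b k, v⟫_ℂ‖ ^ 2) (‖v‖ ^ 2) := by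
    rw [inner_self_eq_norm_sq_to_K] at h
    convert h using 1
    · funext k
      rw [← inner_conj_symm v (b k), RCLike.conj_mul]
      norm_cast
    · norm_cast
  have h2 : ∀ r : ℝ, 0 ≤ r → ENNReal.ofReal (r ^ 2) = ENNReal.ofReal r ^ 2 :=
    fun r hr => ENNReal.ofReal_pow hr 2
  simp_rw [← ofReal_norm, ← h2 _ (norm_nonneg _)]
  rw [← ENNReal.ofReal_tsum_of_nonneg (fun k => by positivity) h'.summable, h'.tsum_eq]

/-- Hilbert-Schmidt operators are compact. -/
lemma isCompactOperator_of_summable {ι : Type*} (b : HilbertBasis ι ℂ H) {A : H →L[ℂ] H}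
    (hA : Summable fun i => ‖A (b i)‖ ^ 2) : IsCompactOperator A := by
  -- These finite-rank truncations of `A` converge in norm: Cauchy-Schwarz bounds the error by the
  -- tail of `∑ ‖A (b i)‖ ^ 2`.
  set T : Finset ι → H →L[ℂ] H := fun F =>
    ∑ i ∈ F, (ContinuousLinearMap.toSpanSingleton ℂ (A (b i))) ∘L (innerSL ℂ (b i)) with hT
  have hTapp : ∀ F v, T F v = ∑ i ∈ F, ⟪b i, v⟫_ℂ • A (b i) := fun F v => by simp [hT]
  have hTc : ∀ F, IsCompactOperator (T F) := fun F => by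
    change T F ∈ compactOperator (RingHom.id ℂ) H H
    refine Submodule.sum_mem _ fun i _ => ?_
    have h : IsCompactOperator (innerSL ℂ (b i)) :=
      isCompactOperator_of_locallyCompactSpace_dom (innerSL ℂ (b i))
    exact h.clm_comp (ContinuousLinearMap.toSpanSingleton ℂ (A (b i)))
  refine isCompactOperator_of_tendsto (l := atTop) (F := T) (f := A) ?_ (Eventually.of_forall hTc)
  classical
  rw [Metric.tendsto_atTop]
  intro ε hε
  obtain ⟨F, hF⟩ := summable_iff_vanishing_norm.1 hA ((ε / 2) ^ 2) (by positivity)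
  refine ⟨F, fun F' hF' => ?_⟩
  rw [dist_eq_norm, norm_sub_rev]
  refine lt_of_le_of_lt (ContinuousLinearMap.opNorm_le_bound _ (by positivity : 0 ≤ ε / 2)
    fun v => ?_) (by linarith)
  have hlim : Tendsto (fun G : Finset ι => ∑ i ∈ G, ⟪b i, v⟫_ℂ • A (b i) - T F' v) atTop
      (𝓝 ((A - T F') v)) := by
    have h := (b.hasSum_repr v).mapL A
    simp only [b.repr_apply_apply, map_smul] at h
    exact h.sub_const _
  refine le_of_tendsto hlim.norm ?_
  filter_upwards [eventually_ge_atTop F'] with G hG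
  rw [hTapp, ← Finset.sum_sdiff hG, add_sub_cancel_right]
  have h1 : ∑ i ∈ G \ F', ‖A (b i)‖ ^ 2 ≤ (ε / 2) ^ 2 := by
    refine (le_abs_self _).trans (hF (G \ F') ?_).le
    exact Finset.disjoint_of_subset_right hF' Finset.sdiff_disjoint
  calc ‖∑ i ∈ G \ F', ⟪b i, v⟫_ℂ • A (b i)‖
      ≤ ∑ i ∈ G \ F', ‖⟪b i, v⟫_ℂ‖ * ‖A (b i)‖ :=
        (norm_sum_le _ _).trans_eq (by simp [norm_smul])
    _ ≤ √(∑ i ∈ G \ F', ‖⟪b i, v⟫_ℂ‖ ^ 2) * √(∑ i ∈ G \ F', ‖A (b i)‖ ^ 2) :=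
        Real.sum_mul_le_sqrt_mul_sqrt _ _ _
    _ ≤ √(‖v‖ ^ 2) * √((ε / 2) ^ 2) := by
        gcongr
        exact b.orthonormal.sum_inner_products_le v
    _ = ε / 2 * ‖v‖ := by
        rw [Real.sqrt_sq (norm_nonneg _), Real.sqrt_sq (by positivity), mul_comm]

lemma norm_sqrt_apply_sq {s : H →L[ℂ] H} (hs : 0 ≤ s) (v : H) :
    ‖CFC.sqrt s v‖ ^ 2 = (⟪v, s v⟫_ℂ).re := by
  have h : ⟪v, s v⟫_ℂ = ⟪CFC.sqrt s v, CFC.sqrt s v⟫_ℂ := by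
    rw [sqrt_adjoint_apply, ← mul_apply_eq_comp, CFC.sqrt_mul_sqrt_self s hs]
  rw [h, inner_self_eq_norm_sq_to_K]
  norm_cast

/-- In the chosen basis `∑ ‖s^{1/2} e_i‖ ^ 2 = tr s = 1`, so the root is Hilbert-Schmidt. A
divergent trace has the default value `0` and is thereby excluded. -/
lemma isCompactOperator_sqrt_of_mem_densityOperators {s : H →L[ℂ] H}
    (hs : s ∈ densityOperators H) : IsCompactOperator (CFC.sqrt s : H →L[ℂ] H) := by
  refine isCompactOperator_of_summable (onb H) ?_
  simp_rw [norm_sqrt_apply_sq hs.1]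
  have hsum : Summable fun i => ⟪onb H i, s (onb H i)⟫_ℂ := by
    by_contra h
    have : tr s = 0 := tsum_eq_zero_of_not_summable h
    exact zero_ne_one (this.symm.trans hs.2)
  exact (Complex.hasSum_re hsum.hasSum).summable

/-- The trace of a positive operator may be computed in any orthonormal basis. -/
lemma posTr_eq_tsum {ι : Type*} (b : HilbertBasis ι ℂ H) {A : H →L[ℂ] H} (hA : 0 ≤ A) :
    posTr A = ∑' k, ENNReal.ofReal (⟪b k, A (b k)⟫_ℂ).re := by
  have h : ∀ v : H, ENNReal.ofReal (⟪v, A v⟫_ℂ).re = ‖CFC.sqrt A v‖ₑ ^ 2 := fun v => by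
    rw [← norm_sqrt_apply_sq hA v, ENNReal.ofReal_pow (norm_nonneg _), ofReal_norm]
  rw [posTr]
  simp_rw [h]
  -- Parseval in the other basis, an interchange of nonnegative sums, and Parseval back.
  calc ∑' i, ‖CFC.sqrt A (onb H i)‖ₑ ^ 2
      = ∑' i, ∑' k, ‖⟪b k, CFC.sqrt A (onb H i)⟫_ℂ‖ₑ ^ 2 := by simp_rw [tsum_enorm_inner_sq]
    _ = ∑' k, ∑' i, ‖⟪onb H i, CFC.sqrt A (b k)⟫_ℂ‖ₑ ^ 2 := by
        rw [ENNReal.tsum_comm]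
        refine tsum_congr fun k => tsum_congr fun i => ?_
        rw [← sqrt_adjoint_apply, ← ofReal_norm, ← ofReal_norm, norm_inner_symm]
    _ = ∑' k, ‖CFC.sqrt A (b k)‖ₑ ^ 2 := by simp_rw [tsum_enorm_inner_sq]

/-- A compact self-adjoint operator has an orthonormal basis of eigenvectors. -/
lemma exists_hilbertBasis_eigenvectors {T : H →L[ℂ] H} (hT : IsCompactOperator T)
    (hsa : IsSelfAdjoint T) :
    ∃ (K : Type u) (b : HilbertBasis K ℂ H), ∀ k, ∃ μ : ℂ, T (b k) = μ • b k := by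
  have hsym : (T : H →ₗ[ℂ] H).IsSymmetric := hsa.isSymmetric
  set E : ℂ → Submodule ℂ H := fun μ => Module.End.eigenspace (T : H →ₗ[ℂ] H) μ with hE
  have hEc : ∀ μ, IsClosed (E μ : Set H) := fun μ => by
    have : (E μ : Set H) = {x | T x = μ • x} := by
      ext x; simp [hE]
    rw [this]
    exact isClosed_eq T.continuous (continuous_const_smul μ)
  have : ∀ μ, CompleteSpace (E μ) := fun μ => (hEc μ).completeSpace_coe
  choose w b _ using fun μ => exists_hilbertBasis ℂ (E μ)
  have hon := hsym.orthogonalFamily_eigenspaces.orthonormal_sigma_orthonormal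
    (v_family := fun μ => b μ) fun μ => (b μ).orthonormal
  refine ⟨_, HilbertBasis.mkOfOrthogonalEqBot hon ?_, ?_⟩
  -- By the spectral theorem the eigenspaces have trivial common orthogonal complement. A vector
  -- orthogonal to the chosen bases is orthogonal to every eigenspace, hence zero.
  · rw [eq_bot_iff, ← ContinuousLinearMap.orthogonalComplement_iSup_eigenspaces_eq_bot hT hsym]
    intro x hx
    rw [Submodule.mem_orthogonal'] at hx ⊢
    intro u hu
    have hle : (⨆ μ, E μ) ≤ (ℂ ∙ x)ᗮ := by
      refine iSup_le fun μ u hu => ?_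
      rw [Submodule.mem_orthogonal_singleton_iff_inner_right]
      have h := ((b μ).hasSum_repr ⟨u, hu⟩).mapL (E μ).subtypeL |>.mapL (innerSL ℂ x)
      refine h.unique ?_
      convert hasSum_zero with i
      simp only [map_smul, Submodule.subtypeL_apply, innerSL_apply_apply]
      have h0 : ⟪x, ((b μ i : E μ) : H)⟫_ℂ = 0 := hx _ (Submodule.subset_span ⟨⟨μ, i⟩, rfl⟩)
      exact (congrArg _ h0).trans (smul_zero _)
    exact (Submodule.mem_orthogonal_singleton_iff_inner_right).1 (hle hu)
  · rintro ⟨μ, i⟩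
    refine ⟨μ, ?_⟩
    simp only [HilbertBasis.coe_mkOfOrthogonalEqBot]
    exact Module.End.mem_eigenspace_iff.1 (b μ i).2

/-- The singular value decomposition of a compact operator. -/
lemma exists_hilbertBasis_singularValues {A : H →L[ℂ] H} (hA : IsCompactOperator A) :
    ∃ (K : Type u) (b : HilbertBasis K ℂ H),
      (Pairwise fun k k' => ⟪A (b k), A (b k')⟫_ℂ = 0) ∧
      ∀ p : ℝ≥0∞, p ≠ 0 → p ≠ ∞ → schattenNorm p A = ellNorm p fun k => ‖A (b k)‖ₑ := by
  have hc : IsCompactOperator (star A * A) := hA.clm_comp (star A)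
  have h0 : 0 ≤ star A * A := star_mul_self_nonneg A
  have hinner : ∀ u v, ⟪u, (star A * A) v⟫_ℂ = ⟪A u, A v⟫_ℂ := fun u v => by
    rw [mul_apply_eq_comp, ContinuousLinearMap.star_eq_adjoint,
      ContinuousLinearMap.adjoint_inner_right]
  obtain ⟨K, b, hb⟩ := exists_hilbertBasis_eigenvectors hc (.of_nonneg h0)
  have hb1 : ∀ k, ‖b k‖ = 1 := b.orthonormal.1
  -- Pairing the eigenvalue equation with `b k` identifies the eigenvalue as `‖A (b k)‖ ^ 2`.
  have heig : ∀ k, (star A * A) (b k) = (((‖A (b k)‖₊ ^ 2 : NNReal) : ℝ) : ℂ) • b k := by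
    intro k
    obtain ⟨μ, hμ⟩ := hb k
    have h := hinner (b k) (b k)
    rw [hμ, inner_smul_right, inner_self_eq_norm_sq_to_K, inner_self_eq_norm_sq_to_K, hb1] at h
    rw [hμ]
    congr 1
    simpa using h
  refine ⟨K, b, fun k k' hkk' => ?_, fun p hp0 hp => ?_⟩
  · change ⟪A (b k), A (b k')⟫_ℂ = 0
    rw [← hinner, heig, inner_smul_right, b.orthonormal.2 hkk', mul_zero]
  · have habs : ∀ k, CFC.abs A (b k) = ((‖A (b k)‖₊ : ℝ) : ℂ) • b k := fun k => by
      rw [CFC.abs, CFC.sqrt_eq_cfc, cfc_apply_of_eigenvector NNReal.continuous_sqrt h0 (heig k),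
        NNReal.sqrt_sq]
    have hpow : ∀ k, (CFC.abs A ^ p.toReal) (b k) =
        (((‖A (b k)‖₊ ^ p.toReal : NNReal) : ℝ) : ℂ) • b k := fun k => by
      rw [CFC.rpow_def]
      exact cfc_apply_of_eigenvector (NNReal.continuous_rpow_const ENNReal.toReal_nonneg)
        (CFC.abs_nonneg A) (habs k)
    rw [schattenNorm, ellNorm, if_neg hp, if_neg hp, posTr_eq_tsum b CFC.rpow_nonneg]
    congr 2
    funext k
    rw [hpow, inner_smul_right, inner_self_eq_norm_sq_to_K, hb1]
    simp only [Complex.ofReal_one, one_pow, mul_one, Complex.ofReal_re, Complex.coe_algebraMap,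
      ENNReal.ofReal_coe_nnreal]
    rw [ENNReal.coe_rpow_of_nonneg _ ENNReal.toReal_nonneg]
    rfl

end Compact

/-! ### Bessel's inequality for orthogonal families in the unit ball -/

section Bessel

variable {H : Type*} [NormedAddCommGroup H] [InnerProductSpace ℂ H]

/-- Pythagoras. Norms below one are allowed because normalising the image of a basis vector may give
zero. -/
lemma norm_sum_smul_sq_le {K : Type*} {v : K → H} (hv : Pairwise fun i j => ⟪v i, v j⟫_ℂ = 0)
    (hv1 : ∀ i, ‖v i‖ ≤ 1) (F : Finset K) (c : K → ℂ) :
    ‖∑ i ∈ F, c i • v i‖ ^ 2 ≤ ∑ i ∈ F, ‖c i‖ ^ 2 := by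
  classical
  induction F using Finset.induction_on with
  | empty => simp
  | insert j F hj ih =>
    rw [Finset.sum_insert hj, Finset.sum_insert hj]
    have h0 : ⟪c j • v j, ∑ i ∈ F, c i • v i⟫_ℂ = 0 := by
      rw [inner_sum]
      refine Finset.sum_eq_zero fun i hi => ?_
      rw [inner_smul_left, inner_smul_right, hv (show j ≠ i from fun h => hj (h ▸ hi)), mul_zero,
        mul_zero]
    have h := norm_add_sq_eq_norm_sq_add_norm_sq_of_inner_eq_zero _ _ h0
    have h1 : ‖c j • v j‖ ^ 2 ≤ ‖c j‖ ^ 2 := by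
      rw [norm_smul]
      gcongr
      exact mul_le_of_le_one_right (norm_nonneg _) (hv1 j)
    nlinarith

/-- Bessel's inequality for an orthogonal family in the unit ball. -/
lemma sum_norm_inner_sq_le {K : Type*} {v : K → H} (hv : Pairwise fun i j => ⟪v i, v j⟫_ℂ = 0)
    (hv1 : ∀ i, ‖v i‖ ≤ 1) (F : Finset K) (x : H) :
    ∑ i ∈ F, ‖⟪v i, x⟫_ℂ‖ ^ 2 ≤ ‖x‖ ^ 2 := by
  set S := ∑ i ∈ F, ‖⟪v i, x⟫_ℂ‖ ^ 2 with hS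
  set y := ∑ i ∈ F, ⟪v i, x⟫_ℂ • v i with hy
  have hS0 : 0 ≤ S := Finset.sum_nonneg fun i _ => by positivity
  have h1 : ‖y‖ ^ 2 ≤ S := norm_sum_smul_sq_le hv hv1 F _
  have h2 : ⟪y, x⟫_ℂ = (S : ℂ) := by
    rw [hy, sum_inner, hS]
    push_cast
    refine Finset.sum_congr rfl fun i _ => ?_
    rw [inner_smul_left, RCLike.conj_mul]
    rfl
  have h3 : S ≤ ‖y‖ * ‖x‖ := by
    have h := norm_inner_le_norm (𝕜 := ℂ) y x
    rwa [h2, Complex.norm_real, Real.norm_of_nonneg hS0] at h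
  -- `2 S ≤ 2 ‖y‖ ‖x‖ ≤ ‖y‖ ^ 2 + ‖x‖ ^ 2 ≤ S + ‖x‖ ^ 2`.
  nlinarith [sq_nonneg (‖y‖ - ‖x‖), norm_nonneg x, norm_nonneg y]

lemma tsum_enorm_inner_sq_le {K : Type*} {v : K → H} (hv : Pairwise fun i j => ⟪v i, v j⟫_ℂ = 0)
    (hv1 : ∀ i, ‖v i‖ ≤ 1) {x : H} (hx : ‖x‖ ≤ 1) : ∑' i, ‖⟪v i, x⟫_ℂ‖ₑ ^ 2 ≤ 1 := by
  rw [ENNReal.tsum_eq_iSup_sum]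
  refine iSup_le fun F => ?_
  have h : ∑ i ∈ F, ‖⟪v i, x⟫_ℂ‖ₑ ^ 2 = ENNReal.ofReal (∑ i ∈ F, ‖⟪v i, x⟫_ℂ‖ ^ 2) := by
    rw [ENNReal.ofReal_sum_of_nonneg fun i _ => by positivity]
    refine Finset.sum_congr rfl fun i _ => ?_
    rw [ENNReal.ofReal_pow (norm_nonneg _), ofReal_norm]
  rw [h]
  refine ENNReal.ofReal_le_one.2 ((sum_norm_inner_sq_le hv hv1 F x).trans ?_)
  exact pow_le_one₀ (norm_nonneg _) hx

/-- The unit vector in the direction of `v`, or `0` if `v = 0`. -/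
def direction (v : H) : H := ((‖v‖⁻¹ : ℝ) : ℂ) • v

lemma norm_direction_le (v : H) : ‖direction v‖ ≤ 1 := by
  rw [direction, norm_smul, Complex.norm_real, norm_inv, norm_norm]
  exact inv_mul_le_one

lemma norm_smul_direction (v : H) : (‖v‖ : ℂ) • direction v = v := by
  rcases eq_or_ne v 0 with rfl | h
  · simp [direction]
  · have : (‖v‖ : ℂ) ≠ 0 := by simpa using h
    rw [direction, smul_smul, Complex.ofReal_inv, mul_inv_cancel₀ this, one_smul]

lemma inner_direction_self (v : H) : ⟪direction v, v⟫_ℂ = ‖v‖ := by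
  rcases eq_or_ne v 0 with rfl | h
  · simp
  · have : (‖v‖ : ℂ) ≠ 0 := by simpa using h
    rw [direction, inner_smul_left, inner_self_eq_norm_sq_to_K, Complex.conj_ofReal]
    simp only [Complex.ofReal_inv, Complex.coe_algebraMap]
    field_simp

lemma pairwise_inner_direction {K : Type*} {v : K → H}
    (hv : Pairwise fun i j => ⟪v i, v j⟫_ℂ = 0) :
    Pairwise fun i j => ⟪direction (v i), direction (v j)⟫_ℂ = 0 := fun i j hij => by
  simp only [direction, inner_smul_left, inner_smul_right, hv hij, mul_zero]

end Bessel

/-! ### Hölder's inequality for Schatten norms -/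

section SchattenHolder

universe u

variable {H : Type u} [NormedAddCommGroup H] [InnerProductSpace ℂ H] [CompleteSpace H]

lemma hasSum_inner_mul_inner_apply {H : Type*} [NormedAddCommGroup H] [InnerProductSpace ℂ H]
    {K : Type*} (b : HilbertBasis K ℂ H) (A : H →L[ℂ] H) (u v : H) :
    HasSum (fun k => ⟪b k, v⟫_ℂ * ⟪u, A (b k)⟫_ℂ) ⟪u, A v⟫_ℂ := by
  have h := ((b.hasSum_repr v).mapL A).mapL (innerSL ℂ u)
  simpa only [b.repr_apply_apply, map_smul, innerSL_apply_apply, smul_eq_mul] using h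

/-- Hölder's inequality for the Schatten norms of compact operators. -/
theorem schattenNorm_one_mul_le {A B : H →L[ℂ] H} (hA : IsCompactOperator A)
    (hB : IsCompactOperator B) {p q : ℝ≥0∞} (hpq : 1 / p + 1 / q = 1) :
    schattenNorm 1 (A * B) ≤ schattenNorm p A * schattenNorm q B := by
  have hp0 : p ≠ 0 := by rintro rfl; simp at hpq
  have hq0 : q ≠ 0 := by rintro rfl; simp at hpq
  obtain ⟨K, y, hy, hyA⟩ := exists_hilbertBasis_singularValues hA
  obtain ⟨L, w, hw, hwB⟩ := exists_hilbertBasis_singularValues hB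
  obtain ⟨I, t, ht, htAB⟩ := exists_hilbertBasis_singularValues
    (A := A * B) (hA.comp_clm B)
  -- At exponent `∞` only this inequality is available and needed: each `‖T (b k)‖` is at most the
  -- operator norm.
  have hle : ∀ {M : Type u} (b : HilbertBasis M ℂ H) (T : H →L[ℂ] H) (r : ℝ≥0∞),
      r ≠ 0 → (∀ r : ℝ≥0∞, r ≠ 0 → r ≠ ∞ → schattenNorm r T = ellNorm r fun k => ‖T (b k)‖ₑ) →
      ellNorm r (fun k => ‖T (b k)‖ₑ) ≤ schattenNorm r T := by
    intro M b T r hr h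
    by_cases hr' : r = ∞
    · simp only [hr', ellNorm, schattenNorm, if_true]
      refine iSup_le fun k => ?_
      have h1 := T.le_opNorm (b k)
      rw [b.orthonormal.1, mul_one] at h1
      rw [← ofReal_norm, ← ofReal_norm]
      exact ENNReal.ofReal_le_ofReal h1
    · exact (h r hr hr').ge
  have hx := pairwise_inner_direction hy
  have hz := pairwise_inner_direction hw
  have hu := pairwise_inner_direction ht
  have hyo : Pairwise fun i j => ⟪y i, y j⟫_ℂ = 0 := fun i j h => y.orthonormal.2 h
  have hto : Pairwise fun i j => ⟪t i, t j⟫_ℂ = 0 := fun i j h => t.orthonormal.2 h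
  have hwo : Pairwise fun i j => ⟪w i, w j⟫_ℂ = 0 := fun i j h => w.orthonormal.2 h
  set x : K → H := fun k => direction (A (y k)) with hxdef
  set z : L → H := fun l => direction (B (w l)) with hzdef
  set u : I → H := fun i => direction ((A * B) (t i)) with hudef
  have hx1 : ∀ k, ‖x k‖ ≤ 1 := fun k => norm_direction_le _
  have hz1 : ∀ l, ‖z l‖ ≤ 1 := fun l => norm_direction_le _
  have hu1 : ∀ i, ‖u i‖ ≤ 1 := fun i => norm_direction_le _
  have hy1 : ∀ k, ‖y k‖ ≤ 1 := fun k => (y.orthonormal.1 k).le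
  have ht1 : ∀ i, ‖t i‖ ≤ 1 := fun i => (t.orthonormal.1 i).le
  have hw1 : ∀ l, ‖w l‖ ≤ 1 := fun l => (w.orthonormal.1 l).le
  rw [htAB 1 one_ne_zero ENNReal.one_ne_top, ellNorm, if_neg ENNReal.one_ne_top]
  simp only [ENNReal.toReal_one, ENNReal.rpow_one, div_one]
  rw [ENNReal.tsum_eq_iSup_sum]
  refine iSup_le fun F => ?_
  -- These are the coefficients `⟪w l, C (x k)⟫` of the contraction `C = ∑ i ∈ F, ⟪u i, ·⟫ t i`.
  -- Moving `C` to the other side gives `hd2`; `hunit` bounds both `C` and its adjoint.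
  set d : L → K → ℂ := fun l k => ∑ i ∈ F, ⟪w l, t i⟫_ℂ * ⟪u i, x k⟫_ℂ with hd
  have hd1 : ∀ l k, d l k = ⟪w l, ∑ i ∈ F, ⟪u i, x k⟫_ℂ • t i⟫_ℂ := fun l k => by
    simp only [hd, inner_sum, inner_smul_right]
    exact Finset.sum_congr rfl fun i _ => mul_comm _ _
  have hd2 : ∀ l k, ‖d l k‖ₑ = ‖⟪x k, ∑ i ∈ F, ⟪t i, w l⟫_ℂ • u i⟫_ℂ‖ₑ := fun l k => by
    rw [← ofReal_norm, ← ofReal_norm, norm_inner_symm]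
    simp only [hd, sum_inner, inner_smul_left, inner_conj_symm]
  have hunit : ∀ {v : I → H} (_ : Pairwise fun i j => ⟪v i, v j⟫_ℂ = 0) (_ : ∀ i, ‖v i‖ ≤ 1)
      {v' : I → H} (_ : Pairwise fun i j => ⟪v' i, v' j⟫_ℂ = 0) (_ : ∀ i, ‖v' i‖ ≤ 1) (a : H),
      ‖a‖ ≤ 1 → ‖∑ i ∈ F, ⟪v i, a⟫_ℂ • v' i‖ ≤ 1 := by
    intro v hv hv1 v' hv' hv1' a ha
    have h := (norm_sum_smul_sq_le hv' hv1' F fun i => ⟪v i, a⟫_ℂ).trans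
      (sum_norm_inner_sq_le hv hv1 F a)
    exact ((sq_le_sq₀ (norm_nonneg _) (norm_nonneg _)).1 h).trans ha
  have hS : ∑ i ∈ F, ‖(A * B) (t i)‖ₑ = ‖∑ i ∈ F, ⟪u i, (A * B) (t i)⟫_ℂ‖ₑ := by
    simp only [hudef, inner_direction_self]
    rw [← Complex.ofReal_sum, ← ofReal_norm (E := ℂ), Complex.norm_real,
      Real.norm_of_nonneg (Finset.sum_nonneg fun i _ => norm_nonneg _),
      ENNReal.ofReal_sum_of_nonneg fun i _ => norm_nonneg _]
    simp only [ofReal_norm]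
  have hl : HasSum (fun l => ∑ i ∈ F, ⟪w l, t i⟫_ℂ * ⟪u i, (A * B) (w l)⟫_ℂ)
      (∑ i ∈ F, ⟪u i, (A * B) (t i)⟫_ℂ) :=
    hasSum_sum fun i _ => hasSum_inner_mul_inner_apply w (A * B) (u i) (t i)
  have hk : ∀ l, HasSum (fun k => ∑ i ∈ F, ⟪w l, t i⟫_ℂ * (⟪y k, B (w l)⟫_ℂ * ⟪u i, A (y k)⟫_ℂ))
      (∑ i ∈ F, ⟪w l, t i⟫_ℂ * ⟪u i, (A * B) (w l)⟫_ℂ) := fun l =>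
    hasSum_sum fun i _ => (hasSum_inner_mul_inner_apply y A (u i) (B (w l))).mul_left _
  have hterm : ∀ l k, ‖∑ i ∈ F, ⟪w l, t i⟫_ℂ * (⟪y k, B (w l)⟫_ℂ * ⟪u i, A (y k)⟫_ℂ)‖ₑ =
      ‖B (w l)‖ₑ * ‖A (y k)‖ₑ * (‖⟪y k, z l⟫_ℂ‖ₑ * ‖d l k‖ₑ) := by
    intro l k
    have h : ∑ i ∈ F, ⟪w l, t i⟫_ℂ * (⟪y k, B (w l)⟫_ℂ * ⟪u i, A (y k)⟫_ℂ) =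
        ((‖B (w l)‖ : ℂ) * (‖A (y k)‖ : ℂ)) * (⟪y k, z l⟫_ℂ * d l k) := by
      rw [hd, Finset.mul_sum, Finset.mul_sum]
      refine Finset.sum_congr rfl fun i _ => ?_
      conv_lhs => rw [← norm_smul_direction (B (w l)), ← norm_smul_direction (A (y k)),
        inner_smul_right, inner_smul_right]
      ring
    rw [h, enorm_mul, enorm_mul, enorm_mul]
    congr 2 <;> rw [← ofReal_norm (E := ℂ), Complex.norm_real, norm_norm, ofReal_norm]
  calc ∑ i ∈ F, ‖(A * B) (t i)‖ₑ
      = ‖∑' l, ∑ i ∈ F, ⟪w l, t i⟫_ℂ * ⟪u i, (A * B) (w l)⟫_ℂ‖ₑ := by rw [hS, hl.tsum_eq]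
    _ ≤ ∑' l, ‖∑ i ∈ F, ⟪w l, t i⟫_ℂ * ⟪u i, (A * B) (w l)⟫_ℂ‖ₑ := enorm_tsum_le_tsum_enorm
    _ ≤ ∑' l, ∑' k, ‖B (w l)‖ₑ * ‖A (y k)‖ₑ * (‖⟪y k, z l⟫_ℂ‖ₑ * ‖d l k‖ₑ) := by
        refine ENNReal.tsum_le_tsum fun l => ?_
        rw [← (hk l).tsum_eq]
        refine enorm_tsum_le_tsum_enorm.trans_eq (tsum_congr fun k => hterm l k)
    _ ≤ ellNorm q (fun l => ‖B (w l)‖ₑ) * ellNorm p (fun k => ‖A (y k)‖ₑ) := by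
        refine tsum_tsum_mul_le_ellNorm_mul_ellNorm _ _ _ (fun l => ?_) (fun k => ?_)
          ((add_comm _ _).trans hpq)
        -- For fixed `l`, Bessel applies to the families `y` and `x`; for fixed `k`, to `z` and `w`.
        · refine tsum_mul_le_one_of_sq (tsum_enorm_inner_sq_le hyo hy1 (hz1 l)) ?_
          simp only [hd2]
          exact tsum_enorm_inner_sq_le hx hx1 (hunit hto ht1 hu hu1 _ (hw1 l))
        · refine tsum_mul_le_one_of_sq ?_ ?_
          · have h : ∀ l, ‖⟪y k, z l⟫_ℂ‖ₑ = ‖⟪z l, y k⟫_ℂ‖ₑ := fun l => by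
              rw [← ofReal_norm, ← ofReal_norm, norm_inner_symm]
            simp only [h]
            exact tsum_enorm_inner_sq_le hz hz1 (hy1 k)
          · simp only [hd1]
            exact tsum_enorm_inner_sq_le hwo hw1 (hunit hu hu1 hto ht1 _ (hx1 k))
    _ ≤ schattenNorm p A * schattenNorm q B := by
        rw [mul_comm]
        exact mul_le_mul' (hle y A p hp0 hyA) (hle w B q hq0 hwB)

end SchattenHolder

/-! ### Weak measurability and Schatten norms -/

section WeakMeasurability

open Filter Topology Polynomial
open scoped NNReal

variable {X : Type*} [MeasurableSpace X]
  {H : Type*} [NormedAddCommGroup H] [InnerProductSpace ℂ H]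

/-- An operator-valued function is weakly measurable if all its matrix coefficients are. -/
def WeaklyMeasurable (A : X → H →L[ℂ] H) : Prop := ∀ u v, Measurable fun x => ⟪u, A x v⟫_ℂ

/-- Distinct basis vectors are `√2` apart, so balls of radius `1/2` about them are disjoint. -/
lemma countable_of_hilbertBasis [TopologicalSpace.SeparableSpace H] {ι : Type*}
    (b : HilbertBasis ι ℂ H) : Countable ι := by
  refine Pairwise.countable_of_isOpen_disjoint (s := fun i => Metric.ball (b i) (1 / 2)) ?_
    (fun i => Metric.isOpen_ball) fun i => ⟨b i, Metric.mem_ball_self (by norm_num)⟩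
  intro i j hij
  refine Metric.ball_disjoint_ball ?_
  have h := norm_sub_sq (𝕜 := ℂ) (b i) (b j)
  rw [b.orthonormal.2 hij, b.orthonormal.1, b.orthonormal.1] at h
  rw [dist_eq_norm]
  have h' : ‖b i - b j‖ ^ 2 = 2 := by rw [h]; norm_num
  nlinarith [norm_nonneg (b i - b j)]

namespace WeaklyMeasurable

lemma const (A : H →L[ℂ] H) : WeaklyMeasurable fun _ : X => A := fun _ _ => measurable_const

lemma add {A B : X → H →L[ℂ] H} (hA : WeaklyMeasurable A) (hB : WeaklyMeasurable B) :
    WeaklyMeasurable fun x => A x + B x := fun u v => by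
  simpa [inner_add_right] using (hA u v).fun_add (hB u v)

lemma const_smul {A : X → H →L[ℂ] H} (hA : WeaklyMeasurable A) (c : ℂ) :
    WeaklyMeasurable fun x => c • A x := fun u v => by
  simpa [inner_smul_right] using (hA u v).const_mul c

lemma of_tendsto {A : ℕ → X → H →L[ℂ] H} {B : X → H →L[ℂ] H} (hA : ∀ n, WeaklyMeasurable (A n))
    (h : ∀ x, Tendsto (fun n => A n x) atTop (𝓝 (B x))) : WeaklyMeasurable B := fun u v => by
  refine measurable_of_tendsto_metrizable (fun n => hA n u v) (tendsto_pi_nhds.2 fun x => ?_)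
  have h1 : Continuous fun T : H →L[ℂ] H => ⟪u, T v⟫_ℂ := by fun_prop
  exact (h1.tendsto _).comp (h x)

/-- Inserting a basis between the factors gives a limit of finite sums of measurable products, along
a countably generated filter since the basis is countable. -/
lemma mul [CompleteSpace H] [TopologicalSpace.SeparableSpace H] {A B : X → H →L[ℂ] H}
    (hA : WeaklyMeasurable A) (hB : WeaklyMeasurable B) :
    WeaklyMeasurable fun x => A x * B x := fun u v => by
  have := countable_of_hilbertBasis (onb H)
  refine measurable_of_tendsto_metrizable' atTop
    (f := fun F x => ∑ i ∈ F, ⟪onb H i, B x v⟫_ℂ * ⟪u, A x (onb H i)⟫_ℂ)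
    (fun F => Finset.measurable_fun_sum _ fun i _ => (hB _ _).mul (hA _ _))
    (tendsto_pi_nhds.2 fun x => ?_)
  exact hasSum_inner_mul_inner_apply (onb H) (A x) u (B x v)

lemma star [CompleteSpace H] {A : X → H →L[ℂ] H} (hA : WeaklyMeasurable A) :
    WeaklyMeasurable fun x => star (A x) := fun u v => by
  have h : ∀ x, ⟪u, (Star.star (A x)) v⟫_ℂ = (starRingEnd ℂ) ⟪v, A x u⟫_ℂ := fun x => by
    rw [ContinuousLinearMap.star_eq_adjoint, ContinuousLinearMap.adjoint_inner_right,
      inner_conj_symm]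
  simp only [h]
  exact Complex.continuous_conj.measurable.comp (hA v u)

lemma aeval [CompleteSpace H] [TopologicalSpace.SeparableSpace H] {A : X → H →L[ℂ] H}
    (hA : WeaklyMeasurable A) (P : ℝ[X]) : WeaklyMeasurable fun x => Polynomial.aeval (A x) P := by
  have hpow : ∀ n : ℕ, WeaklyMeasurable fun x => A x ^ n := fun n => by
    induction n with
    | zero => simpa using const 1
    | succ n ih => simpa only [pow_succ] using ih.mul hA
  induction P using Polynomial.induction_on' with
  | add P Q hP hQ => simpa using hP.add hQ
  | monomial n r =>
    have h : ∀ x, Polynomial.aeval (A x) (monomial n r) = (r : ℂ) • A x ^ n := fun x => by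
      rw [aeval_monomial, Algebra.algebraMap_eq_smul_one, smul_mul_assoc, one_mul]
      exact (Complex.coe_smul r _).symm
    simpa only [h] using (hpow n).const_smul r

/-- By continuity of the quadratic form, positivity can be tested on a countable dense set. -/
lemma measurableSet_nonneg [CompleteSpace H] [TopologicalSpace.SeparableSpace H]
    {A : X → H →L[ℂ] H} (hA : WeaklyMeasurable A) : MeasurableSet {x | 0 ≤ A x} := by
  have hiff : ∀ T : H →L[ℂ] H, 0 ≤ T ↔ ∀ n, 0 ≤ (⟪TopologicalSpace.denseSeq H n,
      T (TopologicalSpace.denseSeq H n)⟫_ℂ).re ∧ (⟪TopologicalSpace.denseSeq H n,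
      T (TopologicalSpace.denseSeq H n)⟫_ℂ).im = 0 := by
    intro T
    have h1 : 0 ≤ T ↔ ∀ v, 0 ≤ (⟪v, T v⟫_ℂ).re ∧ (⟪v, T v⟫_ℂ).im = 0 := by
      rw [ContinuousLinearMap.nonneg_iff_isPositive, ContinuousLinearMap.isPositive_iff_complex]
      refine forall_congr' fun v => ?_
      have hre : (⟪T v, v⟫_ℂ).re = (⟪v, T v⟫_ℂ).re := inner_re_symm (𝕜 := ℂ) _ _
      have him : (⟪T v, v⟫_ℂ).im = -(⟪v, T v⟫_ℂ).im := inner_im_symm (𝕜 := ℂ) _ _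
      rw [Complex.ext_iff]
      simp [hre, him, and_comm, eq_comm]
    rw [h1]
    refine ⟨fun h n => h _, fun h v => ?_⟩
    refine (TopologicalSpace.denseRange_denseSeq H).induction_on
      (p := fun v => 0 ≤ (⟪v, T v⟫_ℂ).re ∧ (⟪v, T v⟫_ℂ).im = 0) v ?_ h
    have hc : Continuous fun v => ⟪v, T v⟫_ℂ := by fun_prop
    exact (isClosed_le continuous_const (Complex.continuous_re.comp hc)).inter
      (isClosed_eq (Complex.continuous_im.comp hc) continuous_const)
  simp only [hiff, Set.ofPred_forall]
  refine MeasurableSet.iInter fun n => ?_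
  exact (measurableSet_le measurable_const (Complex.measurable_re.comp (hA _ _))).inter
    (measurableSet_eq_fun (Complex.measurable_im.comp (hA _ _)) measurable_const)

/-- The approximating polynomials do not depend on `x`. -/
lemma cfc [CompleteSpace H] [TopologicalSpace.SeparableSpace H] {A : X → H →L[ℂ] H}
    (hA : WeaklyMeasurable A) (h0 : ∀ x, 0 ≤ A x) {φ : ℝ≥0 → ℝ≥0} (hφ : Continuous φ) :
    WeaklyMeasurable fun x => _root_.cfc φ (A x) := by
  obtain ⟨P, -, hP⟩ := exists_polynomial_tendsto_cfc (H := H) hφ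
  exact of_tendsto (fun n => hA.aeval (P n)) fun x => hP (A x) (h0 x)

/-- `D` is not assumed positive at every point. Since `CFC.sqrt` is `0` off the positive operators,
replacing non-positive values by `0` leaves the root unchanged. -/
lemma sqrt [CompleteSpace H] [TopologicalSpace.SeparableSpace H] {A : X → H →L[ℂ] H}
    (hA : WeaklyMeasurable A) : WeaklyMeasurable fun x => CFC.sqrt (A x) := by
  classical
  set B : X → H →L[ℂ] H := fun x => if 0 ≤ A x then A x else 0 with hB
  have hBm : WeaklyMeasurable B := fun u v => by
    have h : (fun x => ⟪u, B x v⟫_ℂ) = fun x => if x ∈ {x | 0 ≤ A x} then ⟪u, A x v⟫_ℂ else 0 := by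
      funext x
      by_cases hx : 0 ≤ A x <;> simp [hB, hx]
    rw [h]
    exact Measurable.ite hA.measurableSet_nonneg (hA u v) measurable_const
  have hB0 : ∀ x, 0 ≤ B x := fun x => by
    by_cases hx : 0 ≤ A x <;> simp [hB, hx]
  have hsqrt : ∀ x, CFC.sqrt (A x) = _root_.cfc NNReal.sqrt (B x) := fun x => by
    rw [← CFC.sqrt_eq_cfc]
    by_cases hx : 0 ≤ A x
    · simp [hB, hx]
    · simp [hB, hx, CFC.sqrt_of_not_nonneg hx]
  simpa only [hsqrt] using hBm.cfc hB0 NNReal.continuous_sqrt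

/-- Coefficients of `A* A` give each `‖A x v‖`, and a dense sequence of `v` detects the operator
norm. -/
lemma measurable_norm [CompleteSpace H] [TopologicalSpace.SeparableSpace H] {A : X → H →L[ℂ] H}
    (hA : WeaklyMeasurable A) : Measurable fun x => ‖A x‖ := by
  have hv : ∀ v, Measurable fun x => ‖A x v‖ := fun v => by
    have h : ∀ x, ‖A x v‖ = √(⟪v, (Star.star (A x) * A x) v⟫_ℂ).re := fun x => by
      rw [mul_apply_eq_comp, ContinuousLinearMap.star_eq_adjoint,
        ContinuousLinearMap.adjoint_inner_right]
      exact norm_eq_sqrt_re_inner (𝕜 := ℂ) _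
    simp only [h]
    exact (Complex.measurable_re.comp ((hA.star.mul hA) v v)).sqrt
  refine measurable_of_Iic fun c => ?_
  by_cases hc : 0 ≤ c
  · have h : (fun x => ‖A x‖) ⁻¹' Set.Iic c = ⋂ n, {x | ‖A x (TopologicalSpace.denseSeq H n)‖ ≤
        c * ‖TopologicalSpace.denseSeq H n‖} := by
      ext x
      simp only [Set.mem_preimage, Set.mem_Iic, Set.mem_iInter, Set.mem_ofPred_eq]
      rw [ContinuousLinearMap.opNorm_le_iff hc]
      refine ⟨fun h n => h _, fun h v => ?_⟩
      exact (TopologicalSpace.denseRange_denseSeq H).induction_on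
        (p := fun v => ‖A x v‖ ≤ c * ‖v‖) v
        (isClosed_le (by fun_prop) (by fun_prop)) h
    rw [h]
    exact MeasurableSet.iInter fun n => measurableSet_le (hv _) measurable_const
  · have h : (fun x => ‖A x‖) ⁻¹' Set.Iic c = ∅ := by
      ext x
      simpa using (not_le.1 hc).trans_le (norm_nonneg (A x))
    rw [h]
    exact MeasurableSet.empty

lemma measurable_schattenNorm [CompleteSpace H] [TopologicalSpace.SeparableSpace H]
    {A : X → H →L[ℂ] H} (hA : WeaklyMeasurable A) (p : ℝ≥0∞) :
    Measurable fun x => schattenNorm p (A x) := by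
  by_cases hp : p = ∞
  · simp only [schattenNorm, hp, if_true, ← ofReal_norm]
    exact hA.measurable_norm.ennreal_ofReal
  · simp only [schattenNorm, hp, if_false, posTr]
    have := countable_of_hilbertBasis (onb H)
    have h : WeaklyMeasurable fun x => CFC.abs (A x) ^ p.toReal :=
      (hA.star.mul hA).sqrt.cfc (fun x => CFC.sqrt_nonneg _)
        (NNReal.continuous_rpow_const ENNReal.toReal_nonneg)
    exact (Measurable.tsum fun i =>
      (Complex.measurable_re.comp (h _ _)).ennreal_ofReal).pow_const _

end WeaklyMeasurable

variable [CompleteSpace H]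

lemma tr_rankOne_mul (u : H) (A : H →L[ℂ] H) :
    tr (InnerProductSpace.rankOne ℂ u u * A) = ⟪u, A u⟫_ℂ := by
  rw [tr, ← (hasSum_inner_mul_inner_apply (onb H) A u u).tsum_eq]
  refine tsum_congr fun i => ?_
  rw [mul_apply_eq_comp, InnerProductSpace.rankOne_apply, inner_smul_right, mul_comm]

lemma rankOne_mem_densityOperators {u : H} (hu : ‖u‖ = 1) :
    InnerProductSpace.rankOne ℂ u u ∈ densityOperators H := by
  refine ⟨(ContinuousLinearMap.nonneg_iff_isPositive _).2
    (InnerProductSpace.isPositive_rankOne_self u), ?_⟩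
  have h := tr_rankOne_mul u 1
  rw [mul_one] at h
  simp [h, inner_self_eq_norm_sq_to_K, hu]

/-- Rank-one states give the diagonal coefficients, and polarization gives the others. -/
lemma IsQuantumRandomVariable.weaklyMeasurable {f : X → H →L[ℂ] H}
    (hf : IsQuantumRandomVariable f) : WeaklyMeasurable f := by
  have hdiag : ∀ u, Measurable fun x => ⟪f x u, u⟫_ℂ := fun u => by
    have h1 : Measurable fun x => ⟪direction u, f x (direction u)⟫_ℂ := by
      rcases eq_or_ne u 0 with rfl | hu
      · simp [direction]
      · have hn : ‖direction u‖ = 1 := by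
          rw [direction, norm_smul, Complex.norm_real, norm_inv, norm_norm,
            inv_mul_cancel₀ (norm_ne_zero_iff.2 hu)]
        simpa only [tr_rankOne_mul] using hf _ (rankOne_mem_densityOperators hn)
    have h2 : ∀ x, ⟪f x u, u⟫_ℂ =
        (‖u‖ : ℂ) ^ 2 * (starRingEnd ℂ) ⟪direction u, f x (direction u)⟫_ℂ := fun x => by
      conv_lhs => rw [← norm_smul_direction u]
      rw [map_smul, inner_smul_left, inner_smul_right, Complex.conj_ofReal, inner_conj_symm]
      ring
    simp only [h2]
    exact (Complex.continuous_conj.measurable.comp h1).const_mul _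
  intro u v
  have h : ∀ x, ⟪u, f x v⟫_ℂ = (starRingEnd ℂ) ⟪f x v, u⟫_ℂ := fun x => (inner_conj_symm _ _).symm
  simp only [h]
  refine Complex.continuous_conj.measurable.comp ?_
  have hpol := fun x => inner_map_polarization (f x : H →ₗ[ℂ] H) u v
  simp only [ContinuousLinearMap.coe_coe] at hpol
  simp only [hpol]
  exact ((((hdiag _).sub (hdiag _)).add ((hdiag _).const_mul _)).sub
    ((hdiag _).const_mul _)).div_const _

lemma weaklyMeasurable_of_mem_spanPositive {f : X → H →L[ℂ] H} (hf : f ∈ spanPositive X H) :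
    WeaklyMeasurable f := by
  induction hf using Submodule.span_induction with
  | mem f hf => exact hf.1.weaklyMeasurable
  | zero => exact WeaklyMeasurable.const 0
  | add f g _ _ hf hg => exact hf.add hg
  | smul c f _ hf => exact hf.const_smul c

end WeakMeasurability

end

end OpLp

/-! ### The Hölder inequality for the operator-valued norms -/

open OpLp in
theorem mainTheorem12
    {X : Type*} [TopologicalSpace X] [LocallyCompactSpace X] [T2Space X]
    [MeasurableSpace X] [BorelSpace X]
    {H : Type*} [NormedAddCommGroup H] [InnerProductSpace ℂ H] [CompleteSpace H]
    [TopologicalSpace.SeparableSpace H]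
    (ν : OpLp.POVM X H)
    (ρ : H →L[ℂ] H) (hρ : ρ ∈ OpLp.densityOperators H) (hρ_full : Function.Injective ρ)
    {ι : Type*} (e : HilbertBasis ι ℂ H)
    (D : X → H →L[ℂ] H) (hD : ν.IsRNDeriv (ν.scalar ρ hρ) e D)
    (p q : ENNReal) (hpq : 1 / p + 1 / q = 1)
    (f g : X → H →L[ℂ] H)
    (hf : f ∈ OpLp.spanPositive X H) (hg : g ∈ OpLp.spanPositive X H) :
    (⨆ s ∈ OpLp.densityOperators H,
      MeasureTheory.eLpNorm
        (fun x => OpLp.schattenNorm 1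
          (CFC.sqrt s * CFC.sqrt (D x) * f x * CFC.sqrt (D x) * s *
            CFC.sqrt (D x) * g x * CFC.sqrt (D x) * CFC.sqrt s))
        1 (ν.scalar ρ hρ)) ≤
      OpLp.schattenLpNorm p p (ν.scalar ρ hρ) D f *
        OpLp.schattenLpNorm q q (ν.scalar ρ hρ) D g := by
  refine iSup₂_le fun s hs => ?_
  set r := CFC.sqrt s with hr
  set T : (X → H →L[ℂ] H) → X → H →L[ℂ] H := fun k x =>
    r * CFC.sqrt (D x) * k x * CFC.sqrt (D x) * r with hT
  have hDm := hD.isQuantumRandomVariable.weaklyMeasurable.sqrt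
  have hTm : ∀ k ∈ spanPositive X H, WeaklyMeasurable (T k) := fun k hk =>
    ((((WeaklyMeasurable.const r).mul hDm).mul (weaklyMeasurable_of_mem_spanPositive hk)).mul
      hDm).mul (WeaklyMeasurable.const r)
  -- The rightmost factor `r` is compact and the remaining factors are bounded.
  have hTc : ∀ k x, IsCompactOperator (T k x) := fun k x =>
    (isCompactOperator_sqrt_of_mem_densityOperators hs).clm_comp
      (r * CFC.sqrt (D x) * k x * CFC.sqrt (D x))
  have hprod : ∀ x, r * CFC.sqrt (D x) * f x * CFC.sqrt (D x) * s * CFC.sqrt (D x) * g x *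
      CFC.sqrt (D x) * r = T f x * T g x := fun x => by
    rw [← CFC.sqrt_mul_sqrt_self s hs.1]
    simp only [hT, hr, mul_assoc]
  simp only [hprod, eLpNorm_one_eq_lintegral_enorm, enorm_eq_self]
  calc ∫⁻ x, schattenNorm 1 (T f x * T g x) ∂ν.scalar ρ hρ
      ≤ ∫⁻ x, schattenNorm p (T f x) * schattenNorm q (T g x) ∂ν.scalar ρ hρ :=
        lintegral_mono fun x => schattenNorm_one_mul_le (hTc f x) (hTc g x) hpq
    _ ≤ eLpNorm (fun x => schattenNorm p (T f x)) p (ν.scalar ρ hρ) *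
          eLpNorm (fun x => schattenNorm q (T g x)) q (ν.scalar ρ hρ) :=
        lintegral_mul_le_eLpNorm_mul_eLpNorm ((hTm f hf).measurable_schattenNorm p).aemeasurable
          ((hTm g hg).measurable_schattenNorm q).aemeasurable hpq
    _ ≤ schattenLpNorm p p (ν.scalar ρ hρ) D f * schattenLpNorm q q (ν.scalar ρ hρ) D g :=
        mul_le_mul'
          (le_iSup₂ (f := fun s (_ : s ∈ densityOperators H) =>
            eLpNorm (fun x => schattenNorm p
              (CFC.sqrt s * CFC.sqrt (D x) * f x * CFC.sqrt (D x) * CFC.sqrt s)) p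
              (ν.scalar ρ hρ)) s hs)
          (le_iSup₂ (f := fun s (_ : s ∈ densityOperators H) =>
            eLpNorm (fun x => schattenNorm q
              (CFC.sqrt s * CFC.sqrt (D x) * g x * CFC.sqrt (D x) * CFC.sqrt s)) q
              (ν.scalar ρ hρ)) s hs)
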